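/- All graphs are finite and simple; $d(u)$ and $N(u)$ denote the degree and the neighborhood of a vertex $u$. A vertex $u$ is \emph{very typical} if $d(u)\ge 2$, $d(v)\ne d(u)$ for every $v\in N(u)$, some $x\in N(u)$ has $d(x)>d(u)$, and some $y\in N(u)$ has $d(y)<d(u)$. A vertex $u$ is \emph{typical} if $d(u)\ge 3$ and there are three distinct vertices $x,y,z\in N(u)$ with $d(x)<d(u)=d(y)<d(z)$. Let $f(n)$ and $g(n)$ be the maximum number of very typical vertices and the maximum number of typical vertices, respectively, in a graph of order $n$. Then $$ f(n)=\begin{cases} 0 & \text{if } n\le 4,\\ n-4 & \text{if } 5\le n\le 6,\\ n-3 & \text{if } 7\le n\le 9,\\ n-2 & \text{if } n\ge 10,\end{cases} \qquad g(n)=\begin{cases} 0 & \text{if } n\le 4,\\ n-3 & \text{if } 5\le n\le 8,\\ n-2 & \text{if } n\ge 9.\end{cases} $$ -/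

import Mathlib

namespace VertexTypes

variable {V : Type*} [Fintype V] (G : SimpleGraph V) [DecidableRel G.Adj]

/-- A vertex `u` is very typical if `d(u) ≥ 2`, no neighbor of `u` has the same degree as `u`,
some neighbor has larger degree and some neighbor has smaller degree. -/
def IsVeryTypical (u : V) : Prop :=
  2 ≤ G.degree u ∧
    (∀ v, G.Adj u v → G.degree u ≠ G.degree v) ∧
    (∃ x, G.Adj u x ∧ G.degree u < G.degree x) ∧
    (∃ y, G.Adj u y ∧ G.degree y < G.degree u)

/-- A vertex `u` is typical if `d(u) ≥ 3` and there are three distinct neighbors `x, y, z` of `u`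
with `d(x) < d(u) = d(y) < d(z)`. -/
def IsTypical (u : V) : Prop :=
  3 ≤ G.degree u ∧
    ∃ x y z, (x ≠ y ∧ y ≠ z ∧ x ≠ z) ∧ (G.Adj u x ∧ G.Adj u y ∧ G.Adj u z) ∧
      G.degree x < G.degree u ∧ G.degree u = G.degree y ∧ G.degree y < G.degree z

instance [DecidableEq V] : DecidablePred (IsVeryTypical G) := fun u => by
  unfold IsVeryTypical; infer_instance

instance [DecidableEq V] : DecidablePred (IsTypical G) := fun u => by
  unfold IsTypical; infer_instance

/-- The number of very typical vertices of a finite graph. -/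
def numVeryTypical [DecidableEq V] : ℕ := (Finset.univ.filter (IsVeryTypical G)).card

/-- The number of typical vertices of a finite graph. -/
def numTypical [DecidableEq V] : ℕ := (Finset.univ.filter (IsTypical G)).card

/-- The set of values taken by the number of very typical vertices on the graphs of order `n`. -/
def veryTypicalCounts (n : ℕ) : Set ℕ :=
  {k | ∃ (G : SimpleGraph (Fin n)) (_ : DecidableRel G.Adj), numVeryTypical G = k}

/-- The set of values taken by the number of typical vertices on the graphs of order `n`. -/
def typicalCounts (n : ℕ) : Set ℕ :=
  {k | ∃ (G : SimpleGraph (Fin n)) (_ : DecidableRel G.Adj), numTypical G = k}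

end VertexTypes

set_option linter.unusedSectionVars false

namespace VertexTypes

open Finset

/-! ### Infeasibility of small degree distributions -/

/-! A typical or very typical vertex has a neighbor of smaller and one of larger degree, so a vertex
`a` of minimum and a vertex `b` of maximum degree never count. Hence at most `n - 2` vertices count,
and equality makes `a` and `b` the unique extremes and all other vertices good (`exists_extremal`).

Equality is excluded for small `n` through the degree distribution alone. Let `T` be the vertices of
degree below some `s`, with `b` outside `T`. Each vertex of `T` except `a` sends an edge downwards,
and in the typical case also one inside its degree class, so `T` spans at least `w * (#T - 1)`
ordered adjacent pairs, with `w = 2` (very typical) or `w = 3` (typical). This limits the edges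
leaving `T`, and so the degree sum of the next classes, in the manner of Erdős–Gallai
(`admissible_degreeCount`). A finite search finds no distribution meeting these conditions for `3 ≤
n ≤ 9`, respectively `3 ≤ n ≤ 8`.

For very typical vertices and `n = 4, 5, 6` the value `n - 3` must fail too; this is checked over
all graphs. The bounds are attained by blow-ups of five-vertex patterns for large `n` and by
explicit graphs for the remaining orders. -/

/-- Partial sums `(∑ p i, ∑ i * p i, ∑ (p i) ^ 2)` over `i < t`. -/
def partialSums (p : ℕ → ℕ) : ℕ → ℕ × ℕ × ℕ
  | 0 => (0, 0, 0)
  | t + 1 => ((partialSums p t).1 + p t, (partialSums p t).2.1 + t * p t,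
      (partialSums p t).2.2 + p t * p t)

/-- Necessary conditions for having `c` vertices of degree `t`, where `x` holds the partial sums
below `t` and `past` the earlier ones. -/
def admissible (n w : ℕ) (inner : ℕ → ℕ → ℕ) (loc : ℕ → Bool) (past : List (ℕ × ℕ × ℕ))
    (t : ℕ) (x : ℕ × ℕ × ℕ) (c : ℕ) : Bool :=
  -- The minimum and the maximum degree are each attained once.
  (Nat.blt 0 x.1 || Nat.ble c 1) && (Nat.blt (x.1 + c) n || Nat.ble c 1) &&
  -- For an intermediate class: each of its `c` vertices needs an edge to the vertices below, which
  -- have at most their degree sum minus `w * (x.1 - 1)` edge ends to spare.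
  (Nat.ble x.1 0 || Nat.ble n (x.1 + c) || (loc c && Nat.ble (c + w * (x.1 - 1)) x.2.1)) &&
  -- Erdős–Gallai type bound for the block of classes from the level of `z` up to `t`; `inner`
  -- bounds the ordered adjacent pairs inside the block.
  (x :: past).all fun z => Nat.ble z.1 0 || Nat.ble n z.1 ||
    Nat.ble (x.2.1 + t * c - z.2.1 + w * (z.1 - 1))
      (inner (x.1 + c - z.1) (x.2.2 + c * c - z.2.2) + z.2.1 + (x.1 + c - z.1) * (n - (x.1 + c)))

/-- Exhaustive search for an admissible degree distribution. -/
def search (n w : ℕ) (inner : ℕ → ℕ → ℕ) (loc : ℕ → Bool) :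
    ℕ → ℕ → List (ℕ × ℕ × ℕ) → ℕ × ℕ × ℕ → Bool
  | 0, _, _, x => Nat.beq x.1 n
  | k + 1, t, past, x => (List.range (n - x.1 + 1)).any fun c =>
      admissible n w inner loc past t x c &&
        search n w inner loc k (t + 1) (x :: past) (x.1 + c, x.2.1 + t * c, x.2.2 + c * c)

/-- The list of the partial sums below `t`, latest first. -/
def history (p : ℕ → ℕ) : ℕ → List (ℕ × ℕ × ℕ)
  | 0 => []
  | t + 1 => partialSums p t :: history p t

lemma exists_of_mem_history {p : ℕ → ℕ} {t : ℕ} {z : ℕ × ℕ × ℕ} (hz : z ∈ history p t) :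
    ∃ s < t, z = partialSums p s := by
  induction t with
  | zero => simp [history] at hz
  | succ t ih =>
    rcases List.mem_cons.1 hz with rfl | h
    · exact ⟨t, by omega, rfl⟩
    · obtain ⟨s, hs, rfl⟩ := ih h
      exact ⟨s, by omega, rfl⟩

lemma partialSums_fst_mono (p : ℕ → ℕ) : Monotone fun t => (partialSums p t).1 :=
  monotone_nat_of_le_succ fun t => by simp [partialSums]

/-- The distribution `p` is itself a branch that the search follows to the end, so a failing search
rules out `p`. -/
lemma search_eq_true {n w : ℕ} {inner : ℕ → ℕ → ℕ} {loc : ℕ → Bool} {p : ℕ → ℕ}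
    (hn : (partialSums p n).1 = n)
    (h : ∀ t < n, admissible n w inner loc (history p t) t (partialSums p t) (p t) = true)
    (k t : ℕ) (hk : t + k = n) :
    search n w inner loc k t (history p t) (partialSums p t) = true := by
  induction k generalizing t with
  | zero =>
    obtain rfl : t = n := by omega
    simpa [search] using hn
  | succ k ih =>
    rw [search, List.any_eq_true]
    refine ⟨p t, ?_, ?_⟩
    · have := partialSums_fst_mono p (show t + 1 ≤ n by omega)
      simp only [partialSums, hn] at this
      exact List.mem_range.2 (by omega)
    · rw [h t (by omega), Bool.true_and]
      exact ih (t + 1) (by omega)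

lemma search_veryTypical_eq_false {n : ℕ} (h3 : 3 ≤ n) (h9 : n ≤ 9) :
    search n 2 (fun m q => m * m - q) (fun _ => true) n 0 [] (0, 0, 0) = false := by
  interval_cases n <;> decide +kernel

lemma search_typical_eq_false {n : ℕ} (h3 : 3 ≤ n) (h8 : n ≤ 8) :
    search n 3 (fun m _ => m * m - m) (fun c => !(Nat.beq c 1)) n 0 [] (0, 0, 0) = false := by
  interval_cases n <;> decide +kernel

/-! ### Degree distributions of graphs -/

section EdgeCounts

variable {V : Type*} [Fintype V] [DecidableEq V] (G : SimpleGraph V) [DecidableRel G.Adj]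

/-- The number of pairs of adjacent vertices in `S × T`. -/
def edgeCount (S T : Finset V) : ℕ := ∑ u ∈ S, #{v ∈ T | G.Adj u v}

lemma edgeCount_comm (S T : Finset V) : edgeCount G S T = edgeCount G T S := by
  simp only [edgeCount, card_filter]
  rw [sum_comm]
  simp only [G.adj_comm]

lemma edgeCount_union_right (S : Finset V) {T U : Finset V} (h : Disjoint T U) :
    edgeCount G S (T ∪ U) = edgeCount G S T + edgeCount G S U := by
  simp only [edgeCount, ← sum_add_distrib]
  refine sum_congr rfl fun u _ => ?_
  rw [filter_union, card_union_of_disjoint (disjoint_filter_filter h)]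

lemma edgeCount_univ (S : Finset V) : edgeCount G S univ = ∑ u ∈ S, G.degree u := by
  refine sum_congr rfl fun u _ => ?_
  rw [← G.card_neighborFinset_eq_degree, G.neighborFinset_eq_filter]

lemma edgeCount_le (S T : Finset V) : edgeCount G S T ≤ #S * #T := by
  rw [← smul_eq_mul]
  exact sum_le_card_nsmul _ _ _ fun u _ => card_filter_le _ _

lemma edgeCount_mono_right (S : Finset V) {T U : Finset V} (h : T ⊆ U) :
    edgeCount G S T ≤ edgeCount G S U :=
  sum_le_sum fun _ _ => card_le_card (filter_subset_filter _ h)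

/-- Edges from `S` end in `S`, in `T` or outside both. Those ending in `T` use edge ends of `T` not
spent inside `T`, and those going outside are bounded trivially. -/
lemma sum_degree_add_edgeCount_le {S T : Finset V} (h : Disjoint T S) :
    ∑ u ∈ S, G.degree u + edgeCount G T T ≤
      edgeCount G S S + ∑ u ∈ T, G.degree u + #S * (Fintype.card V - #(T ∪ S)) := by
  have h1 : ∑ u ∈ S, G.degree u =
      edgeCount G S T + edgeCount G S S + edgeCount G S (T ∪ S)ᶜ := by
    rw [← edgeCount_univ, ← union_compl (T ∪ S), edgeCount_union_right G S disjoint_compl_right,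
      edgeCount_union_right G S h]
  have h2 := edgeCount_le G S (T ∪ S)ᶜ
  rw [card_compl] at h2
  have h3 := edgeCount_mono_right G T (subset_univ (T ∪ S))
  rw [edgeCount_univ, edgeCount_union_right G T h, edgeCount_comm G T S] at h3
  omega

lemma card_add_edgeCount_le {S T : Finset V} (h : Disjoint T S)
    (hS : ∀ u ∈ S, ∃ v ∈ T, G.Adj u v) :
    #S + edgeCount G T T ≤ ∑ u ∈ T, G.degree u := by
  have h1 : #S ≤ edgeCount G S T := by
    rw [card_eq_sum_ones]
    refine sum_le_sum fun u hu => card_pos.2 ?_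
    obtain ⟨v, hv, huv⟩ := hS u hu
    exact ⟨v, mem_filter.2 ⟨hv, huv⟩⟩
  have h3 := edgeCount_mono_right G T (subset_univ (T ∪ S))
  rw [edgeCount_univ, edgeCount_union_right G T h, edgeCount_comm G T S] at h3
  omega

/-- If all vertices but one have a neighbor of smaller degree and `e` neighbors of equal degree
in `T`, then `T` spans many edges. -/
lemma le_edgeCount_self {T : Finset V} {a : V} (e : ℕ)
    (hlow : ∀ u ∈ T, u ≠ a → ∃ v ∈ T, G.Adj u v ∧ G.degree v < G.degree u)
    (heq : ∀ u ∈ T, u ≠ a → e ≤ #{v ∈ T | G.Adj u v ∧ G.degree v = G.degree u}) :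
    (2 + e) * (#T - 1) ≤ edgeCount G T T := by
  -- Sort ordered adjacent pairs by comparing degrees. Reversal matches descending with ascending
  -- pairs, so one descending edge per vertex counts twice, whence `2 + e`.
  have hsplit : edgeCount G T T = ∑ u ∈ T, #{v ∈ T | G.Adj u v ∧ G.degree v < G.degree u} +
      ∑ u ∈ T, #{v ∈ T | G.Adj u v ∧ G.degree v = G.degree u} +
      ∑ u ∈ T, #{v ∈ T | G.Adj u v ∧ G.degree u < G.degree v} := by
    simp only [edgeCount, ← sum_add_distrib, card_filter]
    refine sum_congr rfl fun u _ => sum_congr rfl fun v _ => ?_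
    by_cases h : G.Adj u v
    · rcases lt_trichotomy (G.degree u) (G.degree v) with h' | h' | h'
      · simp [h, h', h'.ne', h'.not_gt]
      · simp [h, h']
      · simp [h, h', h'.ne, h'.not_gt]
    · simp [h]
  have hswap : ∑ u ∈ T, #{v ∈ T | G.Adj u v ∧ G.degree u < G.degree v} =
      ∑ u ∈ T, #{v ∈ T | G.Adj u v ∧ G.degree v < G.degree u} := by
    simp only [card_filter]
    rw [sum_comm]
    simp only [G.adj_comm]
  have key : ∀ (f : V → ℕ) (c : ℕ), (∀ u ∈ T, u ≠ a → c ≤ f u) → c * (#T - 1) ≤ ∑ u ∈ T, f u := by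
    intro f c hf
    calc c * (#T - 1) ≤ #(T.erase a) * c := by
          rw [mul_comm]; exact Nat.mul_le_mul_right _ pred_card_le_card_erase
      _ ≤ ∑ u ∈ T.erase a, f u := by
          rw [← smul_eq_mul]
          exact card_nsmul_le_sum _ _ _ fun u hu => hf u (mem_of_mem_erase hu) (ne_of_mem_erase hu)
      _ ≤ ∑ u ∈ T, f u := sum_le_sum_of_subset (erase_subset _ _)
  have h1 := key (fun u => #{v ∈ T | G.Adj u v ∧ G.degree v < G.degree u}) 1 fun u hu hua => by
    obtain ⟨v, hv, h⟩ := hlow u hu hua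
    exact card_pos.2 ⟨v, mem_filter.2 ⟨hv, h⟩⟩
  have h2 := key (fun u => #{v ∈ T | G.Adj u v ∧ G.degree v = G.degree u}) e heq
  rw [hsplit, hswap, add_mul]
  omega

/-- The number of vertices of degree `i`. -/
def degreeCount (i : ℕ) : ℕ := #{v | G.degree v = i}

lemma filter_degree_lt_succ (t : ℕ) : (univ.filter fun v => G.degree v < t + 1) =
    (univ.filter fun v => G.degree v < t) ∪ univ.filter fun v => G.degree v = t := by
  ext v
  simp only [mem_filter, mem_univ, true_and, mem_union]
  omega

lemma disjoint_filter_degree (t : ℕ) : Disjoint (univ.filter fun v => G.degree v < t)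
    (univ.filter fun v => G.degree v = t) :=
  disjoint_filter.2 fun _ _ h => h.ne

lemma partialSums_degreeCount_fst (t : ℕ) :
    (partialSums (degreeCount G) t).1 = #{v | G.degree v < t} := by
  induction t with
  | zero => simp [partialSums]
  | succ t ih =>
    rw [partialSums, ih, degreeCount, filter_degree_lt_succ,
      card_union_of_disjoint (disjoint_filter_degree G t)]

lemma partialSums_degreeCount_snd_fst (t : ℕ) :
    (partialSums (degreeCount G) t).2.1 = ∑ v with G.degree v < t, G.degree v := by
  induction t with
  | zero => simp [partialSums]
  | succ t ih =>
    have : ∑ v with G.degree v = t, G.degree v = t * degreeCount G t := by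
      rw [sum_congr rfl fun v hv => (mem_filter.1 hv).2, sum_const, smul_eq_mul, mul_comm,
        degreeCount]
    rw [partialSums, ih, ← this, filter_degree_lt_succ, sum_union (disjoint_filter_degree G t)]

/-- Turns the sum of squared class sizes into a sum over vertices, the form in which non-neighbors
of equal degree are counted. -/
lemma partialSums_degreeCount_snd_snd (t : ℕ) :
    (partialSums (degreeCount G) t).2.2 =
      ∑ v with G.degree v < t, degreeCount G (G.degree v) := by
  induction t with
  | zero => simp [partialSums]
  | succ t ih =>
    have : ∑ v with G.degree v = t, degreeCount G (G.degree v) =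
        degreeCount G t * degreeCount G t := by
      rw [sum_congr rfl fun v hv => congrArg (degreeCount G) (mem_filter.1 hv).2, sum_const,
        smul_eq_mul]
      rfl
    rw [partialSums, ih, ← this, filter_degree_lt_succ, sum_union (disjoint_filter_degree G t)]

/-- The degree distribution of a graph in which every vertex except a unique one of minimum degree
and a unique one of maximum degree has a neighbor of smaller degree. -/
lemma admissible_degreeCount {a b : V} (ha : ∀ v, v ≠ a → G.degree a < G.degree v)
    (hb : ∀ v, v ≠ b → G.degree v < G.degree b) (e : ℕ) (inner : ℕ → ℕ → ℕ) (loc : ℕ → Bool)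
    (hlow : ∀ u, u ≠ a → u ≠ b → ∃ v, G.Adj u v ∧ G.degree v < G.degree u)
    (heq : ∀ u, u ≠ a → u ≠ b → e ≤ #{v | G.Adj u v ∧ G.degree v = G.degree u})
    (hinner : ∀ (s t : ℕ) (S : Finset V),
      S = univ.filter (fun v => s ≤ G.degree v ∧ G.degree v < t) →
      edgeCount G S S ≤ inner #S (∑ v ∈ S, degreeCount G (G.degree v)))
    (hloc : ∀ u, u ≠ a → u ≠ b → loc (degreeCount G (G.degree u)) = true)
    (hloc0 : loc 0 = true) (t : ℕ) :
    admissible (Fintype.card V) (2 + e) inner loc (history (degreeCount G) t) t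
      (partialSums (degreeCount G) t) (degreeCount G t) = true := by
  set n := Fintype.card V with hn
  have hmin : ∀ s, 0 < #{v | G.degree v < s} → G.degree a < s := fun s hs => by
    obtain ⟨v, hv⟩ := card_pos.1 hs
    rw [mem_filter] at hv
    by_cases h : v = a
    · exact h ▸ hv.2
    · exact (ha v h).trans hv.2
  have hmax : ∀ s, #{v | G.degree v < s} < n → s ≤ G.degree b := fun s hs => by
    by_contra! h
    refine hs.ne ?_
    rw [filter_true_of_mem, card_univ]
    intro v _
    by_cases hv : v = b
    · exact hv ▸ h
    · exact (hb v hv).trans h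
  have hsum : ∀ s, (partialSums (degreeCount G) s).1 + degreeCount G s =
      (partialSums (degreeCount G) (s + 1)).1 := fun s => rfl
  -- The condition on `s` keeps `b` out of the set, so `a` is the only possible exception.
  have htree : ∀ s, s ≤ G.degree b →
      (2 + e) * (#{v | G.degree v < s} - 1) ≤
        edgeCount G {v | G.degree v < s} {v | G.degree v < s} := by
    intro s hs
    have hub : ∀ u, G.degree u < s → u ≠ b := fun u hu h => by subst h; omega
    refine le_edgeCount_self G (a := a) e ?_ ?_
    · intro u hu hua
      simp only [mem_filter, mem_univ, true_and] at hu
      obtain ⟨v, huv, h⟩ := hlow u hua (hub u hu)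
      exact ⟨v, by simp; omega, huv, h⟩
    · intro u hu hua
      simp only [mem_filter, mem_univ, true_and] at hu
      refine (heq u hua (hub u hu)).trans (card_le_card fun v hv => ?_)
      simp only [mem_filter, mem_univ, true_and] at hv ⊢
      exact ⟨by omega, hv⟩
  simp only [admissible, Bool.and_eq_true, Bool.or_eq_true, List.all_eq_true, Nat.ble_eq,
    Nat.blt_eq]
  refine ⟨⟨⟨?_, ?_⟩, ?_⟩, ?_⟩
  · rw [partialSums_degreeCount_fst, or_iff_not_imp_left]
    intro h
    refine card_le_one.2 fun u hu v hv => ?_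
    have key : ∀ u, G.degree u = t → u = a := fun u hu => by
      by_contra hua
      exact h (card_pos.2 ⟨a, by simpa [← hu] using ha u hua⟩)
    simp only [mem_filter, mem_univ, true_and] at hu hv
    rw [key u hu, key v hv]
  · rw [hsum, partialSums_degreeCount_fst, or_iff_not_imp_left]
    intro h
    refine card_le_one.2 fun u hu v hv => ?_
    have key : ∀ u, G.degree u = t → u = b := fun u hu => by
      by_contra hub
      refine h (card_lt_univ_of_notMem (x := b) ?_)
      have := hb u hub
      simp only [mem_filter, mem_univ, true_and]
      omega
    simp only [mem_filter, mem_univ, true_and] at hu hv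
    rw [key u hu, key v hv]
  · rw [hsum]
    simp only [partialSums_degreeCount_fst, partialSums_degreeCount_snd_fst]
    rw [or_iff_not_imp_left]
    intro h
    have h1 := hmin t (by omega)
    have h2 := hmax (t + 1) (by omega)
    have hmid : ∀ u, G.degree u = t → u ≠ a ∧ u ≠ b := fun u hu =>
      ⟨fun h => by subst h; omega, fun h => by subst h; omega⟩
    refine ⟨?_, ?_⟩
    · rcases (filter (fun v => G.degree v = t) univ).eq_empty_or_nonempty with h0 | ⟨u, hu⟩
      · rwa [degreeCount, h0, card_empty]
      · have hu : G.degree u = t := by simpa using hu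
        have := hloc u (hmid u hu).1 (hmid u hu).2
        rwa [hu] at this
    · refine (Nat.add_le_add_left (htree t (by omega)) _).trans ?_
      refine card_add_edgeCount_le G (disjoint_filter.2 fun v _ h => h.ne) fun u hu => ?_
      have hu : G.degree u = t := by simpa using hu
      obtain ⟨v, huv, h⟩ := hlow u (hmid u hu).1 (hmid u hu).2
      exact ⟨v, by simp; omega, huv⟩
  · intro z hz
    obtain ⟨s, hs, rfl⟩ : ∃ s ≤ t, z = partialSums (degreeCount G) s := by
      rcases List.mem_cons.1 hz with rfl | hz
      · exact ⟨t, le_rfl, rfl⟩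
      · obtain ⟨s, hs, rfl⟩ := exists_of_mem_history hz
        exact ⟨s, hs.le, rfl⟩
    have hsum1 : (partialSums (degreeCount G) t).2.1 + t * degreeCount G t =
      (partialSums (degreeCount G) (t + 1)).2.1 := rfl
    have hsum2 : (partialSums (degreeCount G) t).2.2 + degreeCount G t * degreeCount G t =
      (partialSums (degreeCount G) (t + 1)).2.2 := rfl
    rw [hsum, hsum1, hsum2]
    simp only [partialSums_degreeCount_fst, partialSums_degreeCount_snd_fst,
      partialSums_degreeCount_snd_snd]
    rw [or_iff_not_imp_left]
    intro h
    have h1 := hmin s (by omega)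
    have h2 := hmax s (by omega)
    -- `T` is everything below the block and `S` is the block of degrees `s` to `t`.
    set T : Finset V := {v | G.degree v < s} with hT
    set S : Finset V := {v | s ≤ G.degree v ∧ G.degree v < t + 1} with hS
    have hdisj : Disjoint T S := disjoint_filter.2 fun v _ h => by omega
    have hTS : (univ.filter fun v => G.degree v < t + 1) = T ∪ S := by
      ext v
      simp only [hT, hS, mem_filter, mem_union, mem_univ, true_and]
      omega
    rw [hTS, sum_union hdisj, sum_union hdisj, card_union_of_disjoint hdisj,
      Nat.add_sub_cancel_left, Nat.add_sub_cancel_left, Nat.add_sub_cancel_left]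
    have h3 := sum_degree_add_edgeCount_le G hdisj
    rw [card_union_of_disjoint hdisj] at h3
    have h4 := htree s h2
    have h5 := hinner s (t + 1) S hS
    rw [← hn] at h3
    rw [← hT] at h4
    omega

lemma partialSums_degreeCount_card [Nonempty V] :
    (partialSums (degreeCount G) (Fintype.card V)).1 = Fintype.card V := by
  rw [partialSums_degreeCount_fst, filter_true_of_mem fun v _ => G.degree_lt_card_verts v,
    card_univ]

lemma edgeCount_self_le (S : Finset V) : edgeCount G S S ≤ #S * #S - #S := by
  calc edgeCount G S S ≤ ∑ u ∈ S, (#S - 1) := by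
        refine sum_le_sum fun u hu => ?_
        rw [← card_erase_of_mem hu]
        refine card_le_card fun v hv => ?_
        rw [mem_filter] at hv
        exact mem_erase.2 ⟨hv.2.ne', hv.1⟩
    _ = #S * #S - #S := by rw [sum_const, smul_eq_mul, Nat.mul_sub_one]

/-- `S` is a union of full degree classes, and each vertex of `S` misses its entire class, itself
included. -/
lemma edgeCount_self_le_of_ne (hne : ∀ u v, G.Adj u v → G.degree u ≠ G.degree v) (s t : ℕ)
    {S : Finset V} (hS : S = ({v | s ≤ G.degree v ∧ G.degree v < t} : Finset V)) :
    edgeCount G S S ≤ #S * #S - ∑ v ∈ S, degreeCount G (G.degree v) := by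
  refine Nat.le_sub_of_add_le ?_
  rw [edgeCount, ← sum_add_distrib, ← smul_eq_mul]
  refine sum_le_card_nsmul _ _ _ fun u hu => ?_
  rw [degreeCount, ← card_union_of_disjoint]
  · refine card_le_card fun v hv => ?_
    rcases mem_union.1 hv with h | h
    · exact (mem_filter.1 h).1
    · simp only [hS, mem_filter, mem_univ, true_and] at h hu ⊢
      omega
  · refine disjoint_left.2 fun v hv h => ?_
    exact hne u v (mem_filter.1 hv).2 (mem_filter.1 h).2.symm

/-! ### Extremal vertices and the exclusion of `n - 2` -/

/-- If `P`-vertices have neighbors of smaller and of larger degree, then at most `n - 2` vertices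
satisfy `P`. -/
lemma exists_extremal {P : V → Prop} [DecidablePred P] (hV : 2 ≤ Fintype.card V)
    (hlow : ∀ u, P u → ∃ v, G.Adj u v ∧ G.degree v < G.degree u)
    (hup : ∀ u, P u → ∃ v, G.Adj u v ∧ G.degree u < G.degree v) :
    #{u | P u} ≤ Fintype.card V - 2 ∧ (3 ≤ Fintype.card V → #{u | P u} = Fintype.card V - 2 →
      ∃ a b, (∀ v, v ≠ a → G.degree a < G.degree v) ∧ (∀ v, v ≠ b → G.degree v < G.degree b) ∧
        ∀ v, v ≠ a → v ≠ b → P v) := by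
  have : Nonempty V := Fintype.card_pos_iff.1 (by omega)
  obtain ⟨a, -, ha⟩ := exists_min_image univ (fun v => G.degree v) univ_nonempty
  obtain ⟨b, -, hb⟩ := exists_max_image univ (fun v => G.degree v) univ_nonempty
  rcases (univ.filter P).eq_empty_or_nonempty with h0 | ⟨w, hw⟩
  · rw [h0, card_empty]
    exact ⟨by omega, fun _ _ => by omega⟩
  have hw : P w := (mem_filter.1 hw).2
  have hmid : ∀ v, P v → G.degree a < G.degree v ∧ G.degree v < G.degree b := fun v hv => by
    obtain ⟨x, -, hx⟩ := hlow v hv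
    obtain ⟨y, -, hy⟩ := hup v hv
    have := ha x (mem_univ _)
    have := hb y (mem_univ _)
    omega
  have hab : a ≠ b := fun h => by
    subst h
    have := hmid w hw
    omega
  have hsub : univ.filter P ⊆ ({a, b} : Finset V)ᶜ := fun v hv => by
    have := hmid v (mem_filter.1 hv).2
    simp only [mem_compl, mem_insert, mem_singleton, not_or]
    exact ⟨fun h => by subst h; omega, fun h => by subst h; omega⟩
  have hcard : #(({a, b} : Finset V)ᶜ) = Fintype.card V - 2 := by
    rw [card_compl, card_pair hab]
  refine ⟨hcard ▸ card_le_card hsub, fun _ h => ?_⟩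
  have heq := eq_of_subset_of_card_le hsub (by rw [hcard, h])
  have hP : ∀ v, v ≠ a → v ≠ b → P v := fun v hva hvb => by
    have : v ∈ ({a, b} : Finset V)ᶜ := by simp [hva, hvb]
    rw [← heq] at this
    exact (mem_filter.1 this).2
  refine ⟨a, b, fun v hv => ?_, fun v hv => ?_, hP⟩
  · by_cases h : v = b
    · subst h
      have := hmid w hw
      omega
    · exact (hmid v (hP v hv h)).1
  · by_cases h : v = a
    · subst h
      have := hmid w hw
      omega
    · exact (hmid v (hP v h hv)).2

lemma numVeryTypical_le (hV : 2 ≤ Fintype.card V) : numVeryTypical G ≤ Fintype.card V - 2 :=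
  (exists_extremal G hV (fun _ h => h.2.2.2) (fun _ h => h.2.2.1)).1

lemma numTypical_le (hV : 2 ≤ Fintype.card V) : numTypical G ≤ Fintype.card V - 2 :=
  (exists_extremal G hV
    (fun _ ⟨_, x, _, _, _, h, hlt, _⟩ => ⟨x, h.1, hlt⟩)
    (fun _ ⟨_, _, _, z, _, h, _, he, hlt⟩ => ⟨z, h.2.2, he ▸ hlt⟩)).1

lemma numVeryTypical_ne (h3 : 3 ≤ Fintype.card V) (h9 : Fintype.card V ≤ 9) :
    numVeryTypical G ≠ Fintype.card V - 2 := by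
  intro h
  have : Nonempty V := Fintype.card_pos_iff.1 (by omega)
  obtain ⟨a, b, ha, hb, hP⟩ := (exists_extremal G (P := IsVeryTypical G) (by omega)
    (fun _ h => h.2.2.2) (fun _ h => h.2.2.1)).2 h3 h
  -- The extreme vertices have unique degrees, so the whole graph has no edge between vertices of
  -- equal degree.
  have hne : ∀ u v, G.Adj u v → G.degree u ≠ G.degree v := fun u v huv => by
    by_cases hua : u = a
    · subst hua; exact (ha v huv.ne').ne
    by_cases hub : u = b
    · subst hub; exact (hb v huv.ne').ne'
    exact (hP u hua hub).2.1 v huv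
  have hs := search_eq_true (partialSums_degreeCount_card G) (fun t _ =>
    admissible_degreeCount G ha hb 0 (fun m q => m * m - q) (fun _ => true)
      (fun u h1 h2 => (hP u h1 h2).2.2.2) (fun _ _ _ => Nat.zero_le _)
      (fun s t _ hS => edgeCount_self_le_of_ne G hne s t hS) (fun _ _ _ => rfl) rfl t) _ 0
    (Nat.zero_add _)
  have hf := search_veryTypical_eq_false h3 h9
  exact Bool.false_ne_true (hf.symm.trans hs)

lemma numTypical_ne (h3 : 3 ≤ Fintype.card V) (h8 : Fintype.card V ≤ 8) :
    numTypical G ≠ Fintype.card V - 2 := by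
  intro h
  have : Nonempty V := Fintype.card_pos_iff.1 (by omega)
  obtain ⟨a, b, ha, hb, hP⟩ := (exists_extremal G (P := IsTypical G) (by omega)
    (fun _ ⟨_, x, _, _, _, h, hlt, _⟩ => ⟨x, h.1, hlt⟩)
    (fun _ ⟨_, _, _, z, _, h, _, he, hlt⟩ => ⟨z, h.2.2, he ▸ hlt⟩)).2 h3 h
  have hs := search_eq_true (partialSums_degreeCount_card G) (fun t _ =>
    -- Here `e = 1` records the neighbor of equal degree, which also forbids intermediate classes of
    -- size one.
    admissible_degreeCount G ha hb 1 (fun m _ => m * m - m) (fun c => !(Nat.beq c 1))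
      (fun u h1 h2 => by
        obtain ⟨_, x, _, _, _, h, hlt, _⟩ := hP u h1 h2
        exact ⟨x, h.1, hlt⟩)
      (fun u h1 h2 => by
        obtain ⟨_, _, y, _, _, h, _, he, _⟩ := hP u h1 h2
        exact card_pos.2 ⟨y, by simp [h.2.1, he]⟩)
      (fun s t S _ => edgeCount_self_le G S) (fun u h1 h2 => by
        obtain ⟨_, _, y, _, _, h, _, he, _⟩ := hP u h1 h2
        have h1 : 1 < degreeCount G (G.degree u) :=
          one_lt_card.2 ⟨u, by simp, y, by simp [he], h.2.1.ne⟩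
        rw [Bool.not_eq_true', ← Bool.not_eq_true, Nat.beq_eq]
        exact h1.ne') rfl t) _ 0
    (Nat.zero_add _)
  have hf := search_typical_eq_false h3 h8
  exact Bool.false_ne_true (hf.symm.trans hs)

end EdgeCounts

/-! ### Graphs of order at most six -/

/-- Test whether a vertex of degree `d` is very typical, given the adjacency and the degree of each
other vertex. -/
def veryTypicalTest (d : ℕ) (l : List (Bool × ℕ)) : Bool :=
  Nat.ble 2 d && l.any (fun x => x.1 && Nat.blt d x.2) && l.any (fun x => x.1 && Nat.blt x.2 d) &&
    l.all fun x => !(x.1 && Nat.beq d x.2)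

/-- The number of true entries. -/
def trueCount (l : List Bool) : ℕ := (l.map Bool.toNat).sum

lemma veryTypicalTest_four : ∀ a b c d e f : Bool,
    veryTypicalTest (trueCount [a, b, c]) [(a, trueCount [a, d, e]), (b, trueCount [b, d, f]),
      (c, trueCount [c, e, f])] = false := by
  decide +kernel

lemma veryTypicalTest_five : ∀ a b c d e f g h i j : Bool,
    (veryTypicalTest (trueCount [a, b, c, d]) [(a, trueCount [a, e, f, g]),
      (b, trueCount [b, e, h, i]), (c, trueCount [c, f, h, j]), (d, trueCount [d, g, i, j])] &&
    veryTypicalTest (trueCount [a, e, f, g]) [(a, trueCount [a, b, c, d]),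
      (e, trueCount [b, e, h, i]), (f, trueCount [c, f, h, j]), (g, trueCount [d, g, i, j])]) =
    false := by
  decide +kernel

/-- The fifteen letters are the possible edges on six labelled vertices. By symmetry it suffices to
show that the first three vertices are never all very typical. -/
lemma veryTypicalTest_six : ∀ a b c d e f g h i j k l m n o : Bool,
    (veryTypicalTest (trueCount [a, b, c, d, e]) [(a, trueCount [a, f, g, h, i]),
      (b, trueCount [b, f, j, k, l]), (c, trueCount [c, g, j, m, n]),
      (d, trueCount [d, h, k, m, o]), (e, trueCount [e, i, l, n, o])] &&
    veryTypicalTest (trueCount [a, f, g, h, i]) [(a, trueCount [a, b, c, d, e]),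
      (f, trueCount [b, f, j, k, l]), (g, trueCount [c, g, j, m, n]),
      (h, trueCount [d, h, k, m, o]), (i, trueCount [e, i, l, n, o])] &&
    veryTypicalTest (trueCount [b, f, j, k, l]) [(b, trueCount [a, b, c, d, e]),
      (f, trueCount [a, f, g, h, i]), (j, trueCount [c, g, j, m, n]),
      (k, trueCount [d, h, k, m, o]), (l, trueCount [e, i, l, n, o])]) = false := by
  decide +kernel

section SmallOrder

variable {V : Type*} [Fintype V] [DecidableEq V] (G : SimpleGraph V) [DecidableRel G.Adj]

/-- A list covering a type whose length is the cardinality has no repetitions. -/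
lemma nodup_of_forall_mem {l : List V} (hl : ∀ v, v ∈ l) (h : l.length ≤ Fintype.card V) :
    l.Nodup := by
  rw [← Multiset.coe_nodup, ← Multiset.dedup_card_eq_card_iff_nodup]
  refine le_antisymm (Multiset.card_le_card (Multiset.dedup_le _)) ?_
  have : (univ : Finset V) = l.toFinset := by ext v; simpa using hl v
  calc Multiset.card (l : Multiset V) ≤ Fintype.card V := h
    _ = #l.toFinset := by rw [← card_univ, this]
    _ = _ := rfl

lemma degree_eq_trueCount {u : V} {l : List V} (hl : ∀ v, v ∈ u :: l)
    (h : (u :: l).length ≤ Fintype.card V) :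
    G.degree u = trueCount (l.map fun v => decide (G.Adj u v)) := by
  have huniv : (univ : Finset V) = (u :: l).toFinset := by ext v; simpa using hl v
  rw [← G.card_neighborFinset_eq_degree, G.neighborFinset_eq_filter, card_filter, huniv,
    List.sum_toFinset _ (nodup_of_forall_mem hl h)]
  simp [trueCount, Function.comp_def, Bool.toNat, Bool.cond_decide]

lemma IsVeryTypical.test {u : V} (hu : IsVeryTypical G u) {l : List V} (hl : ∀ v, v ∈ u :: l) :
    veryTypicalTest (G.degree u) (l.map fun v => (decide (G.Adj u v), G.degree v)) = true := by
  obtain ⟨h2, hne, ⟨x, hx, hux⟩, ⟨y, hy, huy⟩⟩ := hu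
  have hmem : ∀ v, G.Adj u v → v ∈ l := fun v hv =>
    (List.mem_cons.1 (hl v)).resolve_left hv.ne'
  simp only [veryTypicalTest, Bool.and_eq_true, Nat.ble_eq, List.any_map, List.all_map,
    List.any_eq_true, List.all_eq_true, Function.comp_def, decide_eq_true_eq, Nat.blt_eq,
    Bool.not_eq_true', ← Bool.not_eq_true, Nat.beq_eq]
  exact ⟨⟨⟨h2, x, hmem x hx, hx, hux⟩, y, hmem y hy, hy, huy⟩, fun v _ h => hne v h.1 h.2⟩

lemma decide_adj_comm (u v : V) : decide (G.Adj u v) = decide (G.Adj v u) :=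
  decide_eq_decide.2 (G.adj_comm u v)

lemma numVeryTypical_ne_of_card_eq_four (hV : Fintype.card V = 4) :
    numVeryTypical G ≠ 1 := by
  intro h
  have hc : #(univ.filter (IsVeryTypical G))ᶜ = 3 := by
    rw [card_compl, hV]
    exact congrArg (4 - ·) h
  obtain ⟨u, hs⟩ := card_eq_one.1 h
  obtain ⟨x, y, z, -, -, -, hc⟩ := card_eq_three.1 hc
  have hcov : ∀ t, t ∈ [u, x, y, z] := fun t => by
    have h2 := Finset.ext_iff.1 hc t
    rw [hs] at h2
    simp only [mem_compl, mem_insert, mem_singleton, List.mem_cons, List.not_mem_nil] at h2 ⊢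
    tauto
  have hu := degree_eq_trueCount G (u := u) (l := [x, y, z])
    hcov hV.ge
  have hx := degree_eq_trueCount G (u := x) (l := [u, y, z])
    (fun t => by have := hcov t; simp only [List.mem_cons] at this ⊢; tauto) hV.ge
  have hy := degree_eq_trueCount G (u := y) (l := [u, x, z])
    (fun t => by have := hcov t; simp only [List.mem_cons] at this ⊢; tauto) hV.ge
  have hz := degree_eq_trueCount G (u := z) (l := [u, x, y])
    (fun t => by have := hcov t; simp only [List.mem_cons] at this ⊢; tauto) hV.ge
  simp only [List.map_cons, List.map_nil] at hu hx hy hz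
  rw [decide_adj_comm G x u] at hx
  rw [decide_adj_comm G y u, decide_adj_comm G y x] at hy
  rw [decide_adj_comm G z u, decide_adj_comm G z x, decide_adj_comm G z y] at hz
  have tu := IsVeryTypical.test G (u := u) (l := [x, y, z])
    (mem_filter.1 (hs ▸ (by simp) : u ∈ univ.filter (IsVeryTypical G))).2
    hcov
  simp only [List.map_cons, List.map_nil] at tu
  rw [hu, hx, hy, hz] at tu
  have hf := veryTypicalTest_four (decide (G.Adj u x)) (decide (G.Adj u y)) (decide (G.Adj u z))
    (decide (G.Adj x y)) (decide (G.Adj x z)) (decide (G.Adj y z))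
  simp only [tu, Bool.true_eq_false] at hf

lemma numVeryTypical_ne_of_card_eq_five (hV : Fintype.card V = 5) :
    numVeryTypical G ≠ 2 := by
  intro h
  have hc : #(univ.filter (IsVeryTypical G))ᶜ = 3 := by
    rw [card_compl, hV]
    exact congrArg (5 - ·) h
  obtain ⟨u, v, -, hs⟩ := card_eq_two.1 h
  obtain ⟨x, y, z, -, -, -, hc⟩ := card_eq_three.1 hc
  have hcov : ∀ t, t ∈ [u, v, x, y, z] := fun t => by
    have h2 := Finset.ext_iff.1 hc t
    rw [hs] at h2
    simp only [mem_compl, mem_insert, mem_singleton, List.mem_cons, List.not_mem_nil] at h2 ⊢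
    tauto
  have hu := degree_eq_trueCount G (u := u) (l := [v, x, y, z])
    hcov hV.ge
  have hv := degree_eq_trueCount G (u := v) (l := [u, x, y, z])
    (fun t => by have := hcov t; simp only [List.mem_cons] at this ⊢; tauto) hV.ge
  have hx := degree_eq_trueCount G (u := x) (l := [u, v, y, z])
    (fun t => by have := hcov t; simp only [List.mem_cons] at this ⊢; tauto) hV.ge
  have hy := degree_eq_trueCount G (u := y) (l := [u, v, x, z])
    (fun t => by have := hcov t; simp only [List.mem_cons] at this ⊢; tauto) hV.ge
  have hz := degree_eq_trueCount G (u := z) (l := [u, v, x, y])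
    (fun t => by have := hcov t; simp only [List.mem_cons] at this ⊢; tauto) hV.ge
  simp only [List.map_cons, List.map_nil] at hu hv hx hy hz
  rw [decide_adj_comm G v u] at hv
  rw [decide_adj_comm G x u, decide_adj_comm G x v] at hx
  rw [decide_adj_comm G y u, decide_adj_comm G y v, decide_adj_comm G y x] at hy
  rw [decide_adj_comm G z u, decide_adj_comm G z v, decide_adj_comm G z x,
    decide_adj_comm G z y] at hz
  have tu := IsVeryTypical.test G (u := u) (l := [v, x, y, z])
    (mem_filter.1 (hs ▸ (by simp) : u ∈ univ.filter (IsVeryTypical G))).2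
    hcov
  have tv := IsVeryTypical.test G (u := v) (l := [u, x, y, z])
    (mem_filter.1 (hs ▸ (by simp) : v ∈ univ.filter (IsVeryTypical G))).2
    (fun t => by have := hcov t; simp only [List.mem_cons] at this ⊢; tauto)
  simp only [List.map_cons, List.map_nil] at tu
  rw [hu, hv, hx, hy, hz] at tu
  simp only [List.map_cons, List.map_nil] at tv
  rw [decide_adj_comm G v u] at tv
  rw [hu, hv, hx, hy, hz] at tv
  have hf := veryTypicalTest_five (decide (G.Adj u v)) (decide (G.Adj u x)) (decide (G.Adj u y))
    (decide (G.Adj u z)) (decide (G.Adj v x)) (decide (G.Adj v y)) (decide (G.Adj v z))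
    (decide (G.Adj x y)) (decide (G.Adj x z)) (decide (G.Adj y z))
  simp only [tu, tv, Bool.and_self, Bool.true_eq_false] at hf

lemma numVeryTypical_ne_of_card_eq_six (hV : Fintype.card V = 6) :
    numVeryTypical G ≠ 3 := by
  intro h
  have hc : #(univ.filter (IsVeryTypical G))ᶜ = 3 := by
    rw [card_compl, hV]
    exact congrArg (6 - ·) h
  obtain ⟨u, v, w, -, -, -, hs⟩ := card_eq_three.1 h
  obtain ⟨x, y, z, -, -, -, hc⟩ := card_eq_three.1 hc
  have hcov : ∀ t, t ∈ [u, v, w, x, y, z] := fun t => by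
    have h2 := Finset.ext_iff.1 hc t
    rw [hs] at h2
    simp only [mem_compl, mem_insert, mem_singleton, List.mem_cons, List.not_mem_nil] at h2 ⊢
    tauto
  have hu := degree_eq_trueCount G (u := u) (l := [v, w, x, y, z])
    hcov hV.ge
  have hv := degree_eq_trueCount G (u := v) (l := [u, w, x, y, z])
    (fun t => by have := hcov t; simp only [List.mem_cons] at this ⊢; tauto) hV.ge
  have hw := degree_eq_trueCount G (u := w) (l := [u, v, x, y, z])
    (fun t => by have := hcov t; simp only [List.mem_cons] at this ⊢; tauto) hV.ge
  have hx := degree_eq_trueCount G (u := x) (l := [u, v, w, y, z])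
    (fun t => by have := hcov t; simp only [List.mem_cons] at this ⊢; tauto) hV.ge
  have hy := degree_eq_trueCount G (u := y) (l := [u, v, w, x, z])
    (fun t => by have := hcov t; simp only [List.mem_cons] at this ⊢; tauto) hV.ge
  have hz := degree_eq_trueCount G (u := z) (l := [u, v, w, x, y])
    (fun t => by have := hcov t; simp only [List.mem_cons] at this ⊢; tauto) hV.ge
  simp only [List.map_cons, List.map_nil] at hu hv hw hx hy hz
  -- Orient every pair the same way, so that each edge is represented by a single Boolean.
  rw [decide_adj_comm G v u] at hv
  rw [decide_adj_comm G w u, decide_adj_comm G w v] at hw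
  rw [decide_adj_comm G x u, decide_adj_comm G x v, decide_adj_comm G x w] at hx
  rw [decide_adj_comm G y u, decide_adj_comm G y v, decide_adj_comm G y w,
    decide_adj_comm G y x] at hy
  rw [decide_adj_comm G z u, decide_adj_comm G z v, decide_adj_comm G z w, decide_adj_comm G z x,
    decide_adj_comm G z y] at hz
  have tu := IsVeryTypical.test G (u := u) (l := [v, w, x, y, z])
    (mem_filter.1 (hs ▸ (by simp) : u ∈ univ.filter (IsVeryTypical G))).2
    hcov
  have tv := IsVeryTypical.test G (u := v) (l := [u, w, x, y, z])
    (mem_filter.1 (hs ▸ (by simp) : v ∈ univ.filter (IsVeryTypical G))).2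
    (fun t => by have := hcov t; simp only [List.mem_cons] at this ⊢; tauto)
  have tw := IsVeryTypical.test G (u := w) (l := [u, v, x, y, z])
    (mem_filter.1 (hs ▸ (by simp) : w ∈ univ.filter (IsVeryTypical G))).2
    (fun t => by have := hcov t; simp only [List.mem_cons] at this ⊢; tauto)
  simp only [List.map_cons, List.map_nil] at tu
  rw [hu, hv, hw, hx, hy, hz] at tu
  simp only [List.map_cons, List.map_nil] at tv
  rw [decide_adj_comm G v u] at tv
  rw [hu, hv, hw, hx, hy, hz] at tv
  simp only [List.map_cons, List.map_nil] at tw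
  rw [decide_adj_comm G w u, decide_adj_comm G w v] at tw
  rw [hu, hv, hw, hx, hy, hz] at tw
  have hf := veryTypicalTest_six (decide (G.Adj u v)) (decide (G.Adj u w)) (decide (G.Adj u x))
    (decide (G.Adj u y)) (decide (G.Adj u z)) (decide (G.Adj v w)) (decide (G.Adj v x))
    (decide (G.Adj v y)) (decide (G.Adj v z)) (decide (G.Adj w x)) (decide (G.Adj w y))
    (decide (G.Adj w z)) (decide (G.Adj x y)) (decide (G.Adj x z)) (decide (G.Adj y z))
  simp only [tu, tv, tw, Bool.and_self, Bool.true_eq_false] at hf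

end SmallOrder

/-! ### Small examples -/

/-- The graph on `Fin n` with the given list of edges. -/
def graphOfList (n : ℕ) (l : List (ℕ × ℕ)) : SimpleGraph (Fin n) :=
  SimpleGraph.fromRel fun i j => (i.val, j.val) ∈ l

instance (n : ℕ) (l : List (ℕ × ℕ)) : DecidableRel (graphOfList n l).Adj := fun i j =>
  inferInstanceAs (Decidable (i ≠ j ∧ ((i.val, j.val) ∈ l ∨ (j.val, i.val) ∈ l)))

lemma zero_mem_veryTypicalCounts (n : ℕ) : 0 ∈ veryTypicalCounts n :=
  ⟨⊥, inferInstance, card_eq_zero.2 (filter_eq_empty_iff.2 fun u _ h => by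
    simpa using h.1)⟩

lemma zero_mem_typicalCounts (n : ℕ) : 0 ∈ typicalCounts n :=
  ⟨⊥, inferInstance, card_eq_zero.2 (filter_eq_empty_iff.2 fun u _ h => by
    simpa using h.1)⟩

lemma one_mem_veryTypicalCounts_five : 1 ∈ veryTypicalCounts 5 :=
  ⟨graphOfList 5
    [(0, 3), (0, 4), (1, 3), (2, 3), (2, 4), (3, 4)],
    inferInstance, by decide +kernel⟩

lemma two_mem_veryTypicalCounts_six : 2 ∈ veryTypicalCounts 6 :=
  ⟨graphOfList 6
    [(0, 1), (0, 3), (0, 4), (1, 2), (1, 3), (1, 5), (2, 3), (2, 4), (3, 4), (3, 5), (4, 5)],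
    inferInstance, by decide +kernel⟩

lemma four_mem_veryTypicalCounts_seven : 4 ∈ veryTypicalCounts 7 :=
  ⟨graphOfList 7
    [(0, 1), (0, 2), (0, 4), (1, 2), (1, 5), (1, 6), (2, 4), (2, 5), (2, 6), (3, 5), (3, 6)],
    inferInstance, by decide +kernel⟩

lemma five_mem_veryTypicalCounts_eight : 5 ∈ veryTypicalCounts 8 :=
  ⟨graphOfList 8
    [(0, 1), (0, 3), (0, 5), (0, 6), (1, 2), (1, 3), (1, 4), (1, 5), (1, 6), (2, 3), (2, 6), (2,
    7), (3, 4), (3, 7), (4, 5), (4, 6), (6, 7)],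
    inferInstance, by decide +kernel⟩

lemma six_mem_veryTypicalCounts_nine : 6 ∈ veryTypicalCounts 9 :=
  ⟨graphOfList 9
    [(0, 1), (0, 2), (0, 6), (1, 3), (1, 5), (1, 6), (2, 3), (2, 5), (2, 6), (3, 4), (3, 6), (3,
    7), (4, 5), (4, 6), (4, 8), (5, 6), (5, 7), (7, 8)],
    inferInstance, by decide +kernel⟩

/-- Orders 10 and 11 already attain `n - 2`, but are too small for the blow-up used from order 12
on. -/
lemma eight_mem_veryTypicalCounts_ten : 8 ∈ veryTypicalCounts 10 :=
  ⟨graphOfList 10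
    [(0, 2), (0, 3), (0, 4), (0, 5), (0, 9), (1, 2), (1, 3), (1, 4), (1, 5), (1, 8), (2, 3), (2,
    4), (2, 5), (2, 6), (2, 7), (3, 5), (3, 6), (3, 7), (4, 5), (4, 6), (4, 7), (5, 6), (5, 7),
    (5, 9), (6, 9), (7, 8), (8, 9)],
    inferInstance, by decide +kernel⟩

lemma nine_mem_veryTypicalCounts_eleven : 9 ∈ veryTypicalCounts 11 :=
  ⟨graphOfList 11
    [(0, 3), (0, 4), (0, 5), (0, 6), (0, 8), (0, 9), (1, 2), (1, 3), (1, 4), (1, 5), (2, 7), (2,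
    10), (3, 4), (3, 6), (3, 8), (3, 9), (3, 10), (4, 5), (4, 9), (5, 6), (5, 8), (5, 9), (5,
    10), (6, 7), (6, 9), (7, 8), (7, 9), (8, 9), (9, 10)],
    inferInstance, by decide +kernel⟩

lemma two_mem_typicalCounts_five : 2 ∈ typicalCounts 5 :=
  ⟨graphOfList 5
    [(0, 1), (0, 3), (1, 2), (1, 3), (2, 3), (2, 4), (3, 4)],
    inferInstance, by decide +kernel⟩

lemma three_mem_typicalCounts_six : 3 ∈ typicalCounts 6 :=
  ⟨graphOfList 6
    [(0, 1), (0, 3), (1, 2), (1, 3), (1, 4), (2, 3), (2, 4), (2, 5), (3, 4), (3, 5), (4, 5)],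
    inferInstance, by decide +kernel⟩

lemma four_mem_typicalCounts_seven : 4 ∈ typicalCounts 7 :=
  ⟨graphOfList 7
    [(0, 2), (0, 3), (0, 6), (1, 2), (1, 4), (1, 5), (1, 6), (2, 3), (2, 4), (2, 6), (3, 4), (3,
    6), (4, 5)],
    inferInstance, by decide +kernel⟩

lemma five_mem_typicalCounts_eight : 5 ∈ typicalCounts 8 :=
  ⟨graphOfList 8
    [(0, 1), (0, 2), (0, 6), (0, 7), (1, 4), (1, 5), (1, 7), (2, 6), (2, 7), (3, 4), (3, 5), (3,
    6), (3, 7), (4, 5), (4, 7), (6, 7)],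
    inferInstance, by decide +kernel⟩

/-! ### Transport along isomorphisms -/

section Transport

variable {V : Type*} [Fintype V] [DecidableEq V] (G : SimpleGraph V) [DecidableRel G.Adj]
  {W : Type*} [Fintype W] [DecidableEq W] {H : SimpleGraph W} [DecidableRel H.Adj]

variable {G}

lemma IsVeryTypical.map (e : G ≃g H) {u : V} (h : IsVeryTypical G u) : IsVeryTypical H (e u) := by
  obtain ⟨h2, hne, ⟨x, hx, hux⟩, ⟨y, hy, huy⟩⟩ := h
  refine ⟨by rwa [e.degree_eq], fun v hv => ?_, ⟨e x, e.map_adj_iff.2 hx, ?_⟩,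
    ⟨e y, e.map_adj_iff.2 hy, ?_⟩⟩
  · obtain ⟨v, rfl⟩ := e.surjective v
    rw [e.degree_eq, e.degree_eq]
    exact hne v (e.map_adj_iff.1 hv)
  · rwa [e.degree_eq, e.degree_eq]
  · rwa [e.degree_eq, e.degree_eq]

lemma IsTypical.map (e : G ≃g H) {u : V} (h : IsTypical G u) : IsTypical H (e u) := by
  obtain ⟨h3, x, y, z, ⟨hxy, hyz, hxz⟩, ⟨hx, hy, hz⟩, hlt⟩ := h
  refine ⟨by rwa [e.degree_eq], e x, e y, e z,
    ⟨e.injective.ne hxy, e.injective.ne hyz, e.injective.ne hxz⟩,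
    ⟨e.map_adj_iff.2 hx, e.map_adj_iff.2 hy, e.map_adj_iff.2 hz⟩, ?_⟩
  simpa only [e.degree_eq] using hlt

variable (G)

lemma numVeryTypical_mem : numVeryTypical G ∈ veryTypicalCounts (Fintype.card V) := by
  let e := Fintype.equivFin V
  let f : G.comap e.symm ≃g G := SimpleGraph.Iso.comap e.symm G
  refine ⟨G.comap e.symm, inferInstance, card_equiv f.toEquiv fun u => ?_⟩
  simp only [mem_filter, mem_univ, true_and]
  exact ⟨fun h => h.map f, fun h => by simpa using h.map f.symm⟩

lemma numTypical_mem : numTypical G ∈ typicalCounts (Fintype.card V) := by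
  let e := Fintype.equivFin V
  let f : G.comap e.symm ≃g G := SimpleGraph.Iso.comap e.symm G
  refine ⟨G.comap e.symm, inferInstance, card_equiv f.toEquiv fun u => ?_⟩
  simp only [mem_filter, mem_univ, true_and]
  exact ⟨fun h => h.map f, fun h => by simpa using h.map f.symm⟩

end Transport

/-! ### Blow-ups -/

section BlowUp

variable {k : ℕ} (M : Fin k → Fin k → Bool) (hM : ∀ i j, M i j = M j i) (s : Fin k → ℕ)

/-- The blow-up in which the vertex `i` is replaced by `s i` vertices, spanning a clique or an
independent set according to `M i i`. -/
def blowUp : SimpleGraph (Σ i, Fin (s i)) where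
  Adj x y := x ≠ y ∧ M x.1 y.1 = true
  symm := ⟨fun _ _ h => ⟨h.1.symm, hM _ _ ▸ h.2⟩⟩
  loopless := ⟨fun _ h => h.1 rfl⟩

instance : DecidableRel (blowUp M hM s).Adj := fun x y =>
  inferInstanceAs (Decidable (x ≠ y ∧ M x.1 y.1 = true))

/-- A vertex in a clique class is counted among its own class and must be removed. -/
lemma degree_blowUp (x : Σ i, Fin (s i)) : (blowUp M hM s).degree x =
    (∑ j, if M x.1 j = true then s j else 0) - if M x.1 x.1 = true then 1 else 0 := by
  have h : (blowUp M hM s).neighborFinset x = (univ.filter fun y => M x.1 y.1 = true).erase x := by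
    ext y
    simp only [SimpleGraph.mem_neighborFinset, mem_erase, mem_filter, mem_univ, true_and,
      ne_comm (a := y)]
    rfl
  have hc : #(univ.filter fun y : Σ i, Fin (s i) => M x.1 y.1 = true) =
      ∑ j, if M x.1 j = true then s j else 0 := by
    rw [card_filter, ← univ_sigma_univ, sum_sigma]
    refine sum_congr rfl fun j _ => ?_
    split_ifs <;> simp [*]
  rw [← SimpleGraph.card_neighborFinset_eq_degree, h, card_erase_eq_ite, hc]
  simp only [mem_filter, mem_univ, true_and]
  split_ifs <;> rfl

variable {M hM s}

/-- Degrees are constant on classes, so everything is read off the pattern; `hne` at the class of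
`x` itself forces that class to be independent. -/
lemma isVeryTypical_blowUp {d : Fin k → ℕ} (hd : ∀ x, (blowUp M hM s).degree x = d x.1)
    (x : Σ i, Fin (s i)) (h2 : 2 ≤ d x.1) (hne : ∀ j, M x.1 j = true → d x.1 ≠ d j)
    (hup : ∃ j, 0 < s j ∧ M x.1 j = true ∧ d x.1 < d j)
    (hlow : ∃ j, 0 < s j ∧ M x.1 j = true ∧ d j < d x.1) : IsVeryTypical (blowUp M hM s) x := by
  obtain ⟨i, hi, hxi, hlt⟩ := hup
  obtain ⟨j, hj, hxj, hgt⟩ := hlow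
  refine ⟨by rwa [hd], fun v hv => ?_, ⟨⟨i, 0, hi⟩, ⟨?_, hxi⟩, ?_⟩, ⟨⟨j, 0, hj⟩, ⟨?_, hxj⟩, ?_⟩⟩
  · rw [hd, hd]
    exact hne v.1 hv.2
  · rintro rfl
    exact lt_irrefl _ hlt
  · rwa [hd, hd]
  · rintro rfl
    exact lt_irrefl _ hgt
  · rwa [hd, hd]

/-- The neighbor of equal degree is a second vertex of the same clique class. -/
lemma isTypical_blowUp {d : Fin k → ℕ} (hd : ∀ x, (blowUp M hM s).degree x = d x.1)
    (x : Σ i, Fin (s i)) (h3 : 3 ≤ d x.1) (heq : M x.1 x.1 = true) (hs : 2 ≤ s x.1)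
    (hup : ∃ j, 0 < s j ∧ M x.1 j = true ∧ d x.1 < d j)
    (hlow : ∃ j, 0 < s j ∧ M x.1 j = true ∧ d j < d x.1) : IsTypical (blowUp M hM s) x := by
  obtain ⟨i, hi, hxi, hlt⟩ := hup
  obtain ⟨j, hj, hxj, hgt⟩ := hlow
  obtain ⟨c, b⟩ := x
  have : Nontrivial (Fin (s c)) := Fin.nontrivial_iff_two_le.2 hs
  obtain ⟨y, hy⟩ := exists_ne b
  have hne : ∀ {u v : Σ i, Fin (s i)}, d u.1 ≠ d v.1 → u ≠ v := fun h e => h (e ▸ rfl)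
  refine ⟨by rwa [hd], ⟨j, 0, hj⟩, ⟨c, y⟩, ⟨i, 0, hi⟩, ⟨hne hgt.ne, hne hlt.ne,
    hne (hgt.trans hlt).ne⟩, ⟨⟨hne hgt.ne', hxj⟩, ⟨?_, heq⟩, ⟨hne hlt.ne, hxi⟩⟩, ?_, ?_, ?_⟩
  · intro h
    exact hy (by simpa using h.symm)
  · rwa [hd, hd]
  · rw [hd, hd]
  · rwa [hd, hd]

lemma card_sub_two_le {k : ℕ} {s : Fin (k + 2) → ℕ} (h0 : s 0 = 1) (h1 : s 1 = 1)
    {P : (Σ i, Fin (s i)) → Prop} [DecidablePred P] (hP : ∀ x, x.1 ≠ 0 → x.1 ≠ 1 → P x) :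
    Fintype.card (Σ i, Fin (s i)) - 2 ≤ #{x | P x} := by
  have hsub : ({⟨0, 0, by omega⟩, ⟨1, 0, by omega⟩} : Finset (Σ i, Fin (s i)))ᶜ ⊆
      univ.filter P := by
    rintro ⟨i, a⟩ hx
    simp only [mem_compl, mem_insert, mem_singleton, not_or] at hx
    refine mem_filter.2 ⟨mem_univ _, hP _ ?_ ?_⟩
    · rintro rfl
      refine hx.1 (congrArg _ (Fin.ext ?_))
      have := a.2
      simp only at this ⊢
      omega
    · rintro rfl
      refine hx.2 (congrArg _ (Fin.ext ?_))
      have := a.2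
      simp only at this ⊢
      omega
  refine le_trans ?_ (card_le_card hsub)
  rw [card_compl]
  exact Nat.sub_le_sub_left card_le_two _

end BlowUp

/-- Take the complete 4-partite graph with parts of sizes `1, 2, t, u` and one extra vertex joined
to the part of size `u`. Its degrees satisfy `u < t + 4 < u + 3 < t + u + 1 < t + u + 2`. -/
lemma sub_two_mem_veryTypicalCounts {n : ℕ} (hn : 12 ≤ n) : n - 2 ∈ veryTypicalCounts n := by
  -- The chain of degrees needs exactly `u ≤ t + 3`, `t + 2 ≤ u` and `3 ≤ t`, the last forcing `n ≥
  -- 12`.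
  obtain ⟨t, u, ht, htu, hut, rfl⟩ : ∃ t u, 3 ≤ t ∧ t + 2 ≤ u ∧ u ≤ t + 3 ∧ n = 4 + t + u :=
    ⟨(n - 6) / 2, n - 4 - (n - 6) / 2, by omega, by omega, by omega, by omega⟩
  let M : Fin 5 → Fin 5 → Bool := ![
    ![false, false, false, false, true],
    ![false, false, true, true, true],
    ![false, true, false, true, true],
    ![false, true, true, false, true],
    ![true, true, true, true, false]]
  have hM : ∀ i j, M i j = M j i := by decide
  let s : Fin 5 → ℕ := ![1, 1, 2, t, u]
  let d : Fin 5 → ℕ := ![u, t + u + 2, t + u + 1, u + 3, t + 4]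
  have hcard : Fintype.card (Σ i, Fin (s i)) = 4 + t + u := by
    simp [Fin.sum_univ_five, s]
  have hd : ∀ x, (blowUp M hM s).degree x = d x.1 := by
    rintro ⟨i, a⟩
    rw [degree_blowUp]
    fin_cases i <;> simp [Fin.sum_univ_five, M, s, d] <;> omega
  have hP : ∀ x : Σ i, Fin (s i), x.1 ≠ 0 → x.1 ≠ 1 → IsVeryTypical (blowUp M hM s) x := by
    rintro ⟨i, a⟩ h0 h1
    refine isVeryTypical_blowUp hd _ ?_ ?_ ⟨1, by simp [s], ?_⟩
      -- Smaller neighbors of classes 2, 3, 4 lie in classes 3, 4, 0; the entries for 0 and 1 are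
      -- dummies. Class 1 is the larger neighbor throughout.
      ⟨(![0, 0, 3, 4, 0] : Fin 5 → Fin 5) i, ?_⟩ <;>
    fin_cases i <;> simp [Fin.forall_fin_succ, M, s, d] at h0 h1 ⊢ <;> omega
  have h := numVeryTypical_mem (blowUp M hM s)
  rw [hcard] at h
  convert h using 1
  refine le_antisymm ?_ ?_
  · rw [← hcard]
    exact card_sub_two_le rfl rfl hP
  · rw [← hcard]
    exact numVeryTypical_le _ (by omega)

/-- The graph is the complement of the disjoint union of a star with `q` leaves, a 4-cycle and an
isolated vertex. Its degrees are `5 < q + 3 < q + 4 < q + 5`, where `q ≥ 3` gives the first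
inequality. -/
lemma sub_two_mem_typicalCounts {n : ℕ} (hn : 9 ≤ n) : n - 2 ∈ typicalCounts n := by
  obtain ⟨q, hq, rfl⟩ : ∃ q, 3 ≤ q ∧ n = 6 + q := ⟨n - 6, by omega, by omega⟩
  let M : Fin 5 → Fin 5 → Bool := ![
    ![false, true, true, true, false],
    ![true, false, true, true, true],
    ![true, true, true, false, true],
    ![true, true, false, true, true],
    ![false, true, true, true, true]]
  have hM : ∀ i j, M i j = M j i := by decide
  let s : Fin 5 → ℕ := ![1, 1, 2, 2, q]
  let d : Fin 5 → ℕ := ![5, q + 5, q + 3, q + 3, q + 4]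
  have hcard : Fintype.card (Σ i, Fin (s i)) = 6 + q := by
    simp [Fin.sum_univ_five, s]
  have hd : ∀ x, (blowUp M hM s).degree x = d x.1 := by
    rintro ⟨i, a⟩
    rw [degree_blowUp]
    fin_cases i <;> simp [Fin.sum_univ_five, M, s, d] <;> omega
  have hP : ∀ x : Σ i, Fin (s i), x.1 ≠ 0 → x.1 ≠ 1 → IsTypical (blowUp M hM s) x := by
    rintro ⟨i, a⟩ h0 h1
    refine isTypical_blowUp hd _ ?_ ?_ ?_ ⟨1, by simp [s], ?_⟩
      ⟨(![0, 0, 0, 0, 2] : Fin 5 → Fin 5) i, ?_⟩ <;>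
    fin_cases i <;> simp [M, s, d] at h0 h1 ⊢ <;> omega
  have h := numTypical_mem (blowUp M hM s)
  rw [hcard] at h
  convert h using 1
  refine le_antisymm ?_ ?_
  · rw [← hcard]
    exact card_sub_two_le rfl rfl hP
  · rw [← hcard]
    exact numTypical_le _ (by omega)

/-! ### The upper bounds -/

section UpperBounds

variable {V : Type*} [Fintype V] [DecidableEq V] (G : SimpleGraph V) [DecidableRel G.Adj]

/-- A typical vertex has degree at least 3 and a neighbor of degree at least 4, which needs five
vertices. -/
lemma numTypical_eq_zero (hV : Fintype.card V ≤ 4) : numTypical G = 0 := by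
  refine Finset.card_eq_zero.2 (Finset.filter_eq_empty_iff.2 fun u _ h => ?_)
  obtain ⟨h3, _, _, z, _, _, _, he, hlt⟩ := h
  have : Nonempty V := ⟨u⟩
  have := G.degree_lt_card_verts z
  omega

lemma numVeryTypical_eq_zero (hV : Fintype.card V ≤ 2) : numVeryTypical G = 0 := by
  refine Finset.card_eq_zero.2 (Finset.filter_eq_empty_iff.2 fun u _ h => ?_)
  have : Nonempty V := ⟨u⟩
  have := G.degree_lt_card_verts u
  have := h.1
  omega

lemma numVeryTypical_le_ite : numVeryTypical G ≤
    if Fintype.card V ≤ 4 then 0 else if Fintype.card V ≤ 6 then Fintype.card V - 4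
      else if Fintype.card V ≤ 9 then Fintype.card V - 3 else Fintype.card V - 2 := by
  rcases le_or_gt (Fintype.card V) 2 with h | h
  · rw [numVeryTypical_eq_zero G h]
    exact Nat.zero_le _
  have h1 := numVeryTypical_le G h.le
  have h2 := numVeryTypical_ne G h
  have h4 := numVeryTypical_ne_of_card_eq_four G
  have h5 := numVeryTypical_ne_of_card_eq_five G
  have h6 := numVeryTypical_ne_of_card_eq_six G
  split_ifs <;> omega

lemma numTypical_le_ite : numTypical G ≤
    if Fintype.card V ≤ 4 then 0 else if Fintype.card V ≤ 8 then Fintype.card V - 3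
      else Fintype.card V - 2 := by
  rcases le_or_gt (Fintype.card V) 4 with h | h
  · rw [numTypical_eq_zero G h]
    exact Nat.zero_le _
  have h1 := numTypical_le G (by omega)
  have h2 := numTypical_ne G (by omega)
  split_ifs <;> omega

end UpperBounds

end VertexTypes

theorem theorem1 :
    (∀ n : ℕ, IsGreatest (VertexTypes.veryTypicalCounts n)
      (if n ≤ 4 then 0 else if n ≤ 6 then n - 4 else if n ≤ 9 then n - 3 else n - 2)) ∧
    (∀ n : ℕ, IsGreatest (VertexTypes.typicalCounts n)
      (if n ≤ 4 then 0 else if n ≤ 8 then n - 3 else n - 2)) := by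
  refine ⟨fun n => ⟨?_, ?_⟩, fun n => ⟨?_, ?_⟩⟩
  · rcases le_or_gt n 4 with h4 | h4
    · rw [if_pos h4]
      exact VertexTypes.zero_mem_veryTypicalCounts n
    rcases le_or_gt 12 n with h12 | h12
    · rw [if_neg (by omega), if_neg (by omega), if_neg (by omega)]
      exact VertexTypes.sub_two_mem_veryTypicalCounts h12
    interval_cases n
    · exact VertexTypes.one_mem_veryTypicalCounts_five
    · exact VertexTypes.two_mem_veryTypicalCounts_six
    · exact VertexTypes.four_mem_veryTypicalCounts_seven
    · exact VertexTypes.five_mem_veryTypicalCounts_eight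
    · exact VertexTypes.six_mem_veryTypicalCounts_nine
    · exact VertexTypes.eight_mem_veryTypicalCounts_ten
    · exact VertexTypes.nine_mem_veryTypicalCounts_eleven
  · rintro k ⟨G, _, rfl⟩
    simpa only [Fintype.card_fin] using VertexTypes.numVeryTypical_le_ite G
  · rcases le_or_gt n 4 with h4 | h4
    · rw [if_pos h4]
      exact VertexTypes.zero_mem_typicalCounts n
    rcases le_or_gt 9 n with h9 | h9
    · rw [if_neg (by omega), if_neg (by omega)]
      exact VertexTypes.sub_two_mem_typicalCounts h9
    interval_cases n
    · exact VertexTypes.two_mem_typicalCounts_five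
    · exact VertexTypes.three_mem_typicalCounts_six
    · exact VertexTypes.four_mem_typicalCounts_seven
    · exact VertexTypes.five_mem_typicalCounts_eight
  · rintro k ⟨G, _, rfl⟩
    simpa only [Fintype.card_fin] using VertexTypes.numTypical_le_ite G
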